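/- **Lemma (reduction of boundary data).** Let $s\ge 4$ be an integer, $\mathbb T$ a circle of length $\ell>0$, $T>0$ and $\epsilon>0$. Let $U=U(t,x)$, $P=P(t,x)$, and let $u,v$ be functions on $[0,T]\times\mathbb T\times[0,\infty)$ that form a classical solution of the regularized Prandtl–Hartmann system $$\begin{cases}\partial_t u+u\,\partial_x u+v\,\partial_y u=(U-u)+\epsilon^2\partial_x^2u+\partial_y^2u-\partial_xP,\\ \partial_xu+\partial_yv=0,\\ u|_{t=0}=u_0,\qquad u|_{y=0}=v|_{y=0}=0,\qquad \lim_{y\to+\infty}u(t,x,y)=U(t,x),\end{cases}$$ where $U$ and $P$ satisfy the regularized Bernoulli law $\partial_tU+U\partial_xU-\epsilon^2\partial_x^2U+\partial_xP=0$. Assume that $u$ has partial derivatives $\partial_t^i\partial_x^a\partial_y^bu$, continuous on $[0,T]\times\mathbb T\times[0,\infty)$, for $2i+a+b\le s+2$. Let $w=\partial_yu$ be the vorticity (it then solves the regularized vorticity equation $\partial_tw+u\partial_xw+v\partial_yw=-w+\epsilon^2\partial_x^2w+\partial_y^2w$). Write $D^\rho=\partial_x^{\rho_1}\partial_y^{\rho_2}$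 and $|\rho|=\rho_1+\rho_2$ for $\rho=(\rho_1,\rho_2)\in\mathbb N^2$. Then, for all $t\in[0,T]$ and $x\in\mathbb T$, $$\partial_yw|_{y=0}=\partial_xP-U,$$ $$\partial_y^3w|_{y=0}=(\partial_t-\epsilon^2\partial_x^2)(\partial_xP-U)+(\partial_xP-U)+w\,\partial_xw|_{y=0},$$ and for every integer $k$ with $2\le k\le s/2$, $$\partial_y^{2k+1}w|_{y=0}=\sum_{i=0}^{k}\binom ki(\partial_t-\epsilon^2\partial_x^2)^i(\partial_xP-U)+\sum_{l=0}^{k-1}\epsilon^{2l}\sum_{j=2}^{\max\{2,k-l\}}\ \sum_{\rho\in A^j_{k,l}}C_{k,l,\rho^1,\dots,\rho^j}\prod_{i=1}^{j}D^{\rho^i}w\big|_{y=0},$$ where the real constants $C_{k,l,\rho^1,\dots,\rho^j}$ depend only on the displayed indices (in particular, not on $s$, $\ell$, $T$, $\epsilon$, $U$, $P$, $u_0$ or $(u,v,w)$), and $A^j_{k,l}$ is the set of all $\rho=(\rho^1,\dots,\rho^j)$, $\rho^i=(\rho^i_1,\rho^i_2)\in\mathbb N^2$, such that $$3\sum_{i=1}^j\rho^i_1+\sum_{i=1}^j\rho^i_2=2(k-m)+4l+1\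 \text{ for some integer } 0\le m\le k-l-1,$$ $$\sum_{i=1}^j\rho^i_1\le k+2l-1,\qquad \sum_{i=1}^j\rho^i_2\le 2k-2l-2,\qquad |\rho^i|\le 2k-l-1\ \text{ for all } i=1,\dots,j.$$ -/

import Mathlib

open Set Filter Topology

/-- `f` has continuous mixed partial derivatives `∂ₜⁱ ∂ₓᵃ ∂_yᵇ f` on `[0, T] × ℝ × [0, ∞)`, up to the
boundary, whenever `2 i + a + b ≤ m` (a time derivative counts as two space derivatives). The
function `F i a b` is the partial derivative `∂ₜⁱ ∂ₓᵃ ∂_yᵇ f`; the derivatives in `t` at `0, T`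
and in `y` at `0` are one-sided. -/
def ParabolicC (T : ℝ) (m : ℕ) (f : ℝ → ℝ → ℝ → ℝ) : Prop :=
  ∃ F : ℕ → ℕ → ℕ → ℝ → ℝ → ℝ → ℝ,
    (∀ t ∈ Icc 0 T, ∀ x : ℝ, ∀ y ∈ Ici (0 : ℝ), F 0 0 0 t x y = f t x y) ∧
    ∀ i a b : ℕ,
      (2 * i + a + b ≤ m →
        ContinuousOn (fun p : ℝ × ℝ × ℝ => F i a b p.1 p.2.1 p.2.2)
          (Icc 0 T ×ˢ (univ : Set ℝ) ×ˢ Ici 0)) ∧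
      ∀ t ∈ Icc 0 T, ∀ x : ℝ, ∀ y ∈ Ici (0 : ℝ),
        (2 * (i + 1) + a + b ≤ m →
          HasDerivWithinAt (fun τ => F i a b τ x y) (F (i + 1) a b t x y) (Icc 0 T) t) ∧
        (2 * i + (a + 1) + b ≤ m →
          HasDerivAt (fun ξ => F i a b t ξ y) (F i (a + 1) b t x y) x) ∧
        (2 * i + a + (b + 1) ≤ m →
          HasDerivWithinAt (fun η => F i a b t x η) (F i a (b + 1) t x y) (Ici 0) y)

/-- The time derivative on `[0, T]` (one-sided at the two ends). -/
noncomputable def dt (T : ℝ) (f : ℝ → ℝ → ℝ → ℝ) (t x y : ℝ) : ℝ :=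
  derivWithin (fun τ => f τ x y) (Icc 0 T) t

/-- `D^ρ f = ∂ₓ^{ρ₁} ∂_y^{ρ₂} f` for `ρ = (ρ₁, ρ₂)`, on `y ≥ 0` (one-sided in `y` at `y = 0`). -/
noncomputable def D (ρ : ℕ × ℕ) (f : ℝ → ℝ → ℝ → ℝ) (t x y : ℝ) : ℝ :=
  iteratedDeriv ρ.1 (fun ξ => iteratedDerivWithin ρ.2 (fun η => f t ξ η) (Ici 0) y) x

/-- The vorticity `w = ∂_y u`. -/
noncomputable def vorticity (u : ℝ → ℝ → ℝ → ℝ) : ℝ → ℝ → ℝ → ℝ := D (0, 1) u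

/-- `(u, v)` is a classical solution, on `[0, T] × (ℝ / ℓℤ) × [0, ∞)`, of the regularized
Prandtl-Hartmann system with parameter `ε`, outer flow `U`, pressure `P` and initial velocity `u₀`;
`u` has continuous derivatives of parabolic order at most `m`. Functions on the circle are
`ℓ`-periodic functions of `x`. -/
structure IsRegularizedSolution (m : ℕ) (ℓ T ε : ℝ) (U P : ℝ → ℝ → ℝ) (u₀ : ℝ → ℝ → ℝ)
    (u v : ℝ → ℝ → ℝ → ℝ) : Prop where
  regular_u : ParabolicC T m u
  regular_U : ParabolicC T 2 (fun t x _ => U t x)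
  differentiable_P : ∀ t ∈ Icc 0 T, Differentiable ℝ (P t)
  differentiable_v : ∀ t ∈ Icc 0 T, ∀ x : ℝ, DifferentiableOn ℝ (v t x) (Ici 0)
  periodic_U : ∀ t ∈ Icc 0 T, Function.Periodic (U t) ℓ
  periodic_u : ∀ t ∈ Icc 0 T, ∀ y ∈ Ici (0 : ℝ), Function.Periodic (fun x => u t x y) ℓ
  periodic_v : ∀ t ∈ Icc 0 T, ∀ y ∈ Ici (0 : ℝ), Function.Periodic (fun x => v t x y) ℓ
  momentum : ∀ t ∈ Icc 0 T, ∀ x : ℝ, ∀ y ∈ Ici (0 : ℝ),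
    dt T u t x y + u t x y * D (1, 0) u t x y + v t x y * D (0, 1) u t x y
      = (U t x - u t x y) + ε ^ 2 * D (2, 0) u t x y + D (0, 2) u t x y - deriv (P t) x
  incompressible : ∀ t ∈ Icc 0 T, ∀ x : ℝ, ∀ y ∈ Ici (0 : ℝ),
    D (1, 0) u t x y + D (0, 1) v t x y = 0
  initial : ∀ x : ℝ, ∀ y ∈ Ici (0 : ℝ), u 0 x y = u₀ x y
  noslip_u : ∀ t ∈ Icc 0 T, ∀ x : ℝ, u t x 0 = 0
  noslip_v : ∀ t ∈ Icc 0 T, ∀ x : ℝ, v t x 0 = 0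
  outer_flow : ∀ t ∈ Icc 0 T, ∀ x : ℝ, Tendsto (fun y => u t x y) atTop (𝓝 (U t x))
  bernoulli : ∀ t ∈ Icc 0 T, ∀ x : ℝ,
    derivWithin (fun τ => U τ x) (Icc 0 T) t + U t x * deriv (U t) x
      - ε ^ 2 * iteratedDeriv 2 (U t) x + deriv (P t) x = 0

/-- The boundary datum `∂ₓP - U`. -/
noncomputable def boundaryDatum (U P : ℝ → ℝ → ℝ) (t x : ℝ) : ℝ := deriv (P t) x - U t x

/-- The operator `∂ₜ - ε² ∂ₓ²` on functions of `(t, x)`, `t ∈ [0, T]`. -/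
noncomputable def heatOp (T ε : ℝ) (K : ℝ → ℝ → ℝ) (t x : ℝ) : ℝ :=
  derivWithin (fun τ => K τ x) (Icc 0 T) t - ε ^ 2 * iteratedDeriv 2 (K t) x

/-- The multi-indices `ρ = (ρ¹, …, ρʲ)`, `ρⁱ = (ρⁱ₁, ρⁱ₂) ∈ ℕ²`, such that
`3 ∑ ρⁱ₁ + ∑ ρⁱ₂ = 2 (k - m) + 4 l + 1` for some `0 ≤ m ≤ k - l - 1`, `∑ ρⁱ₁ ≤ k + 2 l - 1`,
`∑ ρⁱ₂ ≤ 2 k - 2 l - 2` and `|ρⁱ| ≤ 2 k - l - 1` for all `i`.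
The last condition makes the ambient box `[0, 2 k)^{2 j}` harmless. -/
def indexSet (k l j : ℕ) : Finset (Fin j → ℕ × ℕ) :=
  (Fintype.piFinset fun _ : Fin j => Finset.range (2 * k) ×ˢ Finset.range (2 * k)).filter fun ρ =>
    (∃ m ∈ Finset.range k, m + l + 1 ≤ k ∧
      3 * ∑ i, (ρ i).1 + ∑ i, (ρ i).2 + 2 * m = 2 * k + 4 * l + 1) ∧
    ∑ i, (ρ i).1 + 1 ≤ k + 2 * l ∧
    ∑ i, (ρ i).2 + 2 * l + 2 ≤ 2 * k ∧
    ∀ i, (ρ i).1 + (ρ i).2 + l + 1 ≤ 2 * k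

/-! Put L = ∂ₜ - ε²∂ₓ² and K = ∂ₓP - U. The momentum equation at the wall gives ∂_y w = K. Its
y-derivative of order b + 1 there reads ∂_y^(b+2) w = (1 + L) ∂_y^b w + Q, where Q is quadratic in
the jet of w because u, v, ∂ₓu and ∂_y v vanish at y = 0. Raising b by two at a time produces (1 +
L)^k K, which is the binomial sum, plus iterates of 1 + L on quadratic terms.

These iterates remain polynomials in spatial derivatives of w. By the product rule L(fg) = (Lf)g +
f(Lg) - 2ε² ∂ₓf ∂ₓg, and on one factor L D^a w = ∂_y² D^a w - D^a w - (pairs of factors). So each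
step either keeps a monomial, adds two y-derivatives, splits a factor into two, or adds two
x-derivatives at the cost of ε². `Admissible` is an invariant of these moves, stronger than
membership in `indexSet`; `exists_expansion` runs the induction.

All polynomials are built as functions of ε and an abstract jet before any solution is introduced,
so their coefficients are universal. -/

/-! ### Polynomials in the jet of the vorticity. -/

/-- The monomial `ε^(2l) ∏ z(ρⁱ)` as a function of `ε` and of the jet `z`. -/
def jetMonomial (l : ℕ) (ρ : List (ℕ × ℕ)) (ε : ℝ) (z : ℕ × ℕ → ℝ) : ℝ :=
  ε ^ (2 * l) * (ρ.map z).prod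

/-- The span of the jet monomials whose indices satisfy `G`. -/
def jetSpan (G : ℕ → List (ℕ × ℕ) → Prop) : Submodule ℝ (ℝ → (ℕ × ℕ → ℝ) → ℝ) :=
  Submodule.span ℝ {f | ∃ l ρ, G l ρ ∧ f = jetMonomial l ρ}

theorem jetMonomial_mem {G : ℕ → List (ℕ × ℕ) → Prop} {l : ℕ} {ρ : List (ℕ × ℕ)} (h : G l ρ) :
    jetMonomial l ρ ∈ jetSpan G :=
  Submodule.subset_span ⟨l, ρ, h, rfl⟩

theorem jetSpan_induction {G : ℕ → List (ℕ × ℕ) → Prop}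
    {p : (ℝ → (ℕ × ℕ → ℝ) → ℝ) → Prop} (mem : ∀ l ρ, G l ρ → p (jetMonomial l ρ)) (zero : p 0)
    (add : ∀ f g, p f → p g → p (f + g)) (smul : ∀ (c : ℝ) f, p f → p (c • f))
    {Φ : ℝ → (ℕ × ℕ → ℝ) → ℝ} (h : Φ ∈ jetSpan G) : p Φ := by
  refine Submodule.span_induction (p := fun f _ => p f) ?_ zero (fun f g _ _ => add f g)
    (fun c f _ => smul c f) h
  rintro _ ⟨l, ρ, h, rfl⟩
  exact mem l ρ h

theorem jetSpan_mono {G G' : ℕ → List (ℕ × ℕ) → Prop} (h : ∀ l ρ, G l ρ → G' l ρ) :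
    jetSpan G ≤ jetSpan G' :=
  Submodule.span_mono fun _ ⟨l, ρ, hG, e⟩ => ⟨l, ρ, h l ρ hG, e⟩

theorem jetMonomial_mul (l l' : ℕ) (ρ ρ' : List (ℕ × ℕ)) :
    jetMonomial l ρ * jetMonomial l' ρ' = jetMonomial (l + l') (ρ ++ ρ') := by
  funext ε z
  simp only [jetMonomial, Pi.mul_apply, List.map_append, List.prod_append]
  ring

theorem mul_jetMonomial_mem {G G' : ℕ → List (ℕ × ℕ) → Prop} {δ : ℕ} {σ : List (ℕ × ℕ)}
    (h : ∀ l ρ, G l ρ → G' (l + δ) (ρ ++ σ)) {Φ : ℝ → (ℕ × ℕ → ℝ) → ℝ} (hΦ : Φ ∈ jetSpan G) :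
    Φ * jetMonomial δ σ ∈ jetSpan G' := by
  refine jetSpan_induction (p := fun Φ => Φ * jetMonomial δ σ ∈ jetSpan G')
    ?_ ?_ ?_ ?_ hΦ
  · intro l ρ hG; rw [jetMonomial_mul]; exact jetMonomial_mem (h l ρ hG)
  · rw [zero_mul]; exact zero_mem _
  · intro f g hf hg; rw [add_mul]; exact add_mem hf hg
  · intro c f hf; rw [smul_mul_assoc]; exact Submodule.smul_mem _ _ hf

theorem jetMonomial_mul_mem {G G' : ℕ → List (ℕ × ℕ) → Prop} {δ : ℕ} {σ : List (ℕ × ℕ)}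
    (h : ∀ l ρ, G l ρ → G' (δ + l) (σ ++ ρ)) {Φ : ℝ → (ℕ × ℕ → ℝ) → ℝ} (hΦ : Φ ∈ jetSpan G) :
    jetMonomial δ σ * Φ ∈ jetSpan G' := by
  refine jetSpan_induction (p := fun Φ => jetMonomial δ σ * Φ ∈ jetSpan G')
    ?_ ?_ ?_ ?_ hΦ
  · intro l ρ hG; rw [jetMonomial_mul]; exact jetMonomial_mem (h l ρ hG)
  · rw [mul_zero]; exact zero_mem _
  · intro f g hf hg; rw [mul_add]; exact add_mem hf hg
  · intro c f hf; rw [mul_smul_comm]; exact Submodule.smul_mem _ _ hf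

/-! ### The transport term at the wall. -/

/-- The `b`-th derivative of a product, in terms of the derivatives of the factors. -/
def leibniz : ℕ → (ℕ → ℝ) → (ℕ → ℝ) → ℝ
  | 0, f, g => f 0 * g 0
  | b + 1, f, g => leibniz b (fun p => f (p + 1)) g + leibniz b f fun p => g (p + 1)

theorem hasDerivWithinAt_leibniz {s : Set ℝ} {y : ℝ} (b : ℕ) (f g : ℕ → ℝ → ℝ)
    (hf : ∀ p ≤ b, HasDerivWithinAt (f p) (f (p + 1) y) s y)
    (hg : ∀ p ≤ b, HasDerivWithinAt (g p) (g (p + 1) y) s y) :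
    HasDerivWithinAt (fun η => leibniz b (fun p => f p η) fun p => g p η)
      (leibniz (b + 1) (fun p => f p y) fun p => g p y) s y := by
  induction b generalizing f g with
  | zero => exact (hf 0 le_rfl).mul (hg 0 le_rfl)
  | succ b ih =>
    exact (ih (fun p => f (p + 1)) g (fun p hp => hf (p + 1) (by omega))
      fun p hp => hg p (by omega)).add (ih f (fun p => g (p + 1)) (fun p hp => hf p (by omega))
      fun p hp => hg (p + 1) (by omega))

/-- Binomial coefficients never matter: it is enough to know which pairs of orders occur. -/
theorem leibniz_mem (S : Submodule ℝ (ℝ → (ℕ × ℕ → ℝ) → ℝ)) (b : ℕ)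
    (f g : ℕ → (ℕ × ℕ → ℝ) → ℝ)
    (h : ∀ p q, p + q = b → (fun _ z => f p z * g q z) ∈ S) :
    (fun _ z => leibniz b (fun p => f p z) fun p => g p z) ∈ S := by
  induction b generalizing f g with
  | zero => exact h 0 0 rfl
  | succ b ih =>
    exact add_mem (ih (fun p => f (p + 1)) g fun p q e => h (p + 1) q (by omega))
      (ih f (fun p => g (p + 1)) fun p q e => h p (q + 1) (by omega))

/-- `∂_y^p u` at the wall, in terms of the jet of the vorticity. -/
def wallU (z : ℕ × ℕ → ℝ) : ℕ → ℝ
  | 0 => 0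
  | p + 1 => z (0, p)

/-- `∂_x ∂_y^p u` at the wall. -/
def wallUx (z : ℕ × ℕ → ℝ) : ℕ → ℝ
  | 0 => 0
  | p + 1 => z (1, p)

/-- `∂_y^p v` at the wall. -/
def wallV (z : ℕ × ℕ → ℝ) : ℕ → ℝ
  | 0 => 0
  | p + 1 => -wallUx z p

/-- `∂_y^b (u ∂_x u + v ∂_y u)` at the wall. -/
def wallTransport (b : ℕ) (z : ℕ × ℕ → ℝ) : ℝ :=
  leibniz b (wallU z) (wallUx z) + leibniz b (wallV z) fun p => z (0, p)

/-- Every term containing an undifferentiated u, ∂ₓu or v, or ∂_y v, vanishes at the wall. Each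
surviving factor has absorbed a y-derivative into w, or two in the case of v, which is why the
y-orders add up to b - 1. -/
theorem wallTransport_mem (b : ℕ) :
    (fun _ z => wallTransport (b + 1) z) ∈ jetSpan fun l ρ => l = 0 ∧
      ∃ c d : ℕ × ℕ, ρ = [c, d] ∧ c.1 + d.1 = 1 ∧ c.2 + d.2 + 1 = b := by
  have key : ∀ p q, p + q + 1 = b → (fun (_ : ℝ) (z : ℕ × ℕ → ℝ) => z (0, p) * z (1, q)) ∈
      jetSpan fun l ρ => l = 0 ∧
      ∃ c d : ℕ × ℕ, ρ = [c, d] ∧ c.1 + d.1 = 1 ∧ c.2 + d.2 + 1 = b := by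
    intro p q h
    have := jetMonomial_mem (G := fun l ρ => l = 0 ∧
      ∃ c d : ℕ × ℕ, ρ = [c, d] ∧ c.1 + d.1 = 1 ∧ c.2 + d.2 + 1 = b) (l := 0)
      (ρ := [(0, p), (1, q)]) ⟨rfl, _, _, rfl, rfl, h⟩
    convert this using 3
    simp [jetMonomial]
  refine add_mem (leibniz_mem _ _ (fun p z => wallU z p) (fun p z => wallUx z p) ?_)
    (leibniz_mem _ _ (fun p z => wallV z p) (fun p z => z (0, p)) ?_)
  · rintro (_ | p) (_ | q) h
    · simp only [wallU, zero_mul]; exact zero_mem _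
    · simp only [wallU, zero_mul]; exact zero_mem _
    · simp only [wallUx, mul_zero]; exact zero_mem _
    · exact key p q (by omega)
  · rintro (_ | _ | p) q h
    · simp only [wallV, zero_mul]; exact zero_mem _
    · simp only [wallV, wallUx, neg_zero, zero_mul]; exact zero_mem _
    · have := neg_mem (key q p (by omega))
      convert this using 3
      simp [wallV, wallUx]; ring

/-! ### Combinatorics of the indices. -/

/-- `ρ'` is `ρ` with one more `x`-derivative on one of its entries. -/
inductive XStep : List (ℕ × ℕ) → List (ℕ × ℕ) → Prop
  | head (a ρ) : XStep (a :: ρ) ((a.1 + 1, a.2) :: ρ)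
  | cons (a) {ρ ρ'} : XStep ρ ρ' → XStep (a :: ρ) (a :: ρ')

/-- The monomials `ε^(2δ) ρ'` which occur in `∂ₜ - ε² ∂ₓ²` of the monomial `ρ`. -/
inductive HeatStep : List (ℕ × ℕ) → ℕ → List (ℕ × ℕ) → Prop
  | self (a ρ) : HeatStep (a :: ρ) 0 (a :: ρ)
  | diffuse (a ρ) : HeatStep (a :: ρ) 0 ((a.1, a.2 + 2) :: ρ)
  | split (a c d ρ) : c.1 + d.1 = a.1 + 1 → c.2 + d.2 + 1 = a.2 → HeatStep (a :: ρ) 0 (c :: d :: ρ)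
  | cross (a) {ρ ρ'} : XStep ρ ρ' → HeatStep (a :: ρ) 1 ((a.1 + 1, a.2) :: ρ')
  | cons (a) {ρ δ ρ'} : HeatStep ρ δ ρ' → HeatStep (a :: ρ) δ (a :: ρ')

/-- The total number of `x`-derivatives. -/
def xOrder (ρ : List (ℕ × ℕ)) : ℕ := (ρ.map Prod.fst).sum

/-- The total number of `y`-derivatives. -/
def yOrder (ρ : List (ℕ × ℕ)) : ℕ := (ρ.map Prod.snd).sum

@[simp] theorem xOrder_cons (a ρ) : xOrder (a :: ρ) = a.1 + xOrder ρ := by simp [xOrder]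
@[simp] theorem yOrder_cons (a ρ) : yOrder (a :: ρ) = a.2 + yOrder ρ := by simp [yOrder]
@[simp] theorem xOrder_nil : xOrder [] = 0 := rfl
@[simp] theorem yOrder_nil : yOrder [] = 0 := rfl

theorem XStep.orders {ρ ρ'} (h : XStep ρ ρ') :
    ρ'.length = ρ.length ∧ xOrder ρ' = xOrder ρ + 1 ∧ yOrder ρ' = yOrder ρ := by
  induction h with
  | head a ρ => simp; omega
  | cons a _ ih => simp; omega

/-- The slack A makes the induction go through: on passing to the tail, the order of the discarded
head is absorbed into A. -/
theorem XStep.bound {ρ ρ'} (h : XStep ρ ρ') (l A : ℕ)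
    (H : ∀ a ∈ ρ, a.1 + a.2 + l ≤ xOrder ρ + yOrder ρ + A) :
    ∀ a ∈ ρ', a.1 + a.2 + l ≤ xOrder ρ' + yOrder ρ' + A := by
  induction h generalizing A with
  | head a ρ =>
    simp only [List.mem_cons, forall_eq_or_imp, xOrder_cons, yOrder_cons] at H ⊢
    exact ⟨by omega, fun c hc => by have := H.2 c hc; omega⟩
  | @cons a ρ ρ' h ih =>
    have ho := h.orders
    simp only [List.mem_cons, forall_eq_or_imp, xOrder_cons, yOrder_cons] at H ⊢
    refine ⟨by omega, fun c hc => ?_⟩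
    have := ih (A + a.1 + a.2) (fun c hc => by have := H.2 c hc; omega) c hc
    omega

theorem HeatStep.orders {ρ δ ρ'} (h : HeatStep ρ δ ρ') :
    (δ = 0 ∧ ρ'.length = ρ.length ∧ xOrder ρ' = xOrder ρ ∧
      (yOrder ρ' = yOrder ρ ∨ yOrder ρ' = yOrder ρ + 2)) ∨
    (δ = 0 ∧ ρ'.length = ρ.length + 1 ∧ xOrder ρ' = xOrder ρ + 1 ∧ yOrder ρ' + 1 = yOrder ρ) ∨
    (δ = 1 ∧ ρ'.length = ρ.length ∧ xOrder ρ' = xOrder ρ + 2 ∧ yOrder ρ' = yOrder ρ) := by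
  induction h with
  | self a ρ => simp
  | diffuse a ρ => simp; omega
  | split a c d ρ h1 h2 => simp; omega
  | cross a h => have := h.orders; simp; omega
  | cons a h ih => simp; omega

/-- The hypothesis says that the factors other than any given one have total order at least l, up to
A. Splitting preserves the total order. A cross term differentiates two distinct factors, so any one
factor gains at most 1 while the total gains 2, which pays for the extra power of ε². -/
theorem HeatStep.bound {ρ δ ρ'} (h : HeatStep ρ δ ρ') (l A : ℕ)
    (H : ∀ a ∈ ρ, a.1 + a.2 + l ≤ xOrder ρ + yOrder ρ + A) :
    ∀ a ∈ ρ', a.1 + a.2 + (l + δ) ≤ xOrder ρ' + yOrder ρ' + A := by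
  induction h generalizing A with
  | self a ρ => exact H
  | diffuse a ρ =>
    simp only [List.mem_cons, forall_eq_or_imp, xOrder_cons, yOrder_cons] at H ⊢
    exact ⟨by omega, fun c hc => by have := H.2 c hc; omega⟩
  | split a c d ρ h1 h2 =>
    simp only [List.mem_cons, forall_eq_or_imp, xOrder_cons, yOrder_cons] at H ⊢
    exact ⟨by omega, by omega, fun c hc => by have := H.2 c hc; omega⟩
  | @cross a ρ ρ' h =>
    have ho := h.orders
    simp only [List.mem_cons, forall_eq_or_imp, xOrder_cons, yOrder_cons] at H ⊢
    refine ⟨by omega, fun c hc => ?_⟩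
    have := h.bound l (A + a.1 + a.2) (fun c hc => by have := H.2 c hc; omega) c hc
    omega
  | @cons a ρ δ ρ' h ih =>
    have ho := h.orders
    simp only [List.mem_cons, forall_eq_or_imp, xOrder_cons, yOrder_cons] at H ⊢
    refine ⟨by omega, fun c hc => ?_⟩
    have := ih (A + a.1 + a.2) (fun c hc => by have := H.2 c hc; omega) c hc
    omega

/-- The monomials which occur in the expression of `∂_y^(2k+1) w` at the wall. -/
def Admissible (k l : ℕ) (ρ : List (ℕ × ℕ)) : Prop :=
  2 ≤ ρ.length ∧ xOrder ρ + 1 = ρ.length + 2 * l ∧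
    (∃ r, yOrder ρ + 3 * ρ.length + 2 * r + 2 * l = 2 * k + 4) ∧
    ∀ a ∈ ρ, a.1 + a.2 + l ≤ xOrder ρ + yOrder ρ

theorem Admissible.keep {k l ρ} (h : Admissible k l ρ) : Admissible (k + 1) l ρ := by
  obtain ⟨h1, h2, ⟨r, h3⟩, h4⟩ := h
  exact ⟨h1, h2, ⟨r + 1, by omega⟩, h4⟩

/-- The number r counts the steps in which the monomial is merely kept. Every other move raises
yOrder + 3·length + 2l by exactly 2, matching the growth of 2k. -/
theorem Admissible.heatStep {k l ρ δ ρ'} (h : Admissible k l ρ) (hs : HeatStep ρ δ ρ') :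
    Admissible (k + 1) (l + δ) ρ' := by
  obtain ⟨h1, h2, ⟨r, h3⟩, h4⟩ := h
  have ho := hs.orders
  refine ⟨by omega, by omega, ?_, hs.bound l 0 h4⟩
  rcases ho with ⟨_, _, _, _ | _⟩ | _ | _
  · exact ⟨r + 1, by omega⟩
  · exact ⟨r, by omega⟩
  · exact ⟨r, by omega⟩
  · exact ⟨r, by omega⟩

theorem Admissible.order_lt {k l ρ} (h : Admissible k l ρ) {a} (ha : a ∈ ρ) :
    a.1 + a.2 + l + 1 ≤ 2 * k := by
  obtain ⟨h1, h2, ⟨r, h3⟩, h4⟩ := h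
  have := h4 a ha
  omega

/-- The quadratic terms that newly enter at step k + 1. -/
theorem admissible_pair (k : ℕ) {c d : ℕ × ℕ} (h1 : c.1 + d.1 = 1) (h2 : c.2 + d.2 = 2 * k) :
    Admissible (k + 1) 0 [c, d] := by
  refine ⟨by simp, by simp; omega, ⟨0, by simp; omega⟩, ?_⟩
  simp
  omega

/-- The integer m of `indexSet` is r: eliminating the length gives 3·xOrder + yOrder = 2(k - r) + 4l
+ 1. The case k = 1 must be excluded because w ∂ₓw is admissible there but violates the bound on
x-derivatives. -/
theorem Admissible.mem_indexSet {k l ρ} (hk : 2 ≤ k) (h : Admissible k l ρ) :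
    l < k ∧ ρ.length ∈ Finset.Icc 2 (max 2 (k - l)) ∧ ρ.get ∈ indexSet k l ρ.length := by
  have hlt := fun a ha => h.order_lt (a := a) ha
  obtain ⟨h1, h2, ⟨r, h3⟩, h4⟩ := h
  have e1 : ∑ i, (ρ.get i).1 = xOrder ρ := by
    rw [xOrder, ← List.sum_ofFn]; congr 1; apply List.ext_get <;> simp
  have e2 : ∑ i, (ρ.get i).2 = yOrder ρ := by
    rw [yOrder, ← List.sum_ofFn]; congr 1; apply List.ext_get <;> simp
  refine ⟨by omega, by rw [Finset.mem_Icc]; omega, ?_⟩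
  rw [indexSet, Finset.mem_filter, e1, e2]
  refine ⟨?_, ⟨r, ?_, ?_, ?_⟩, ?_, ?_, ?_⟩
  · rw [Fintype.mem_piFinset]
    intro i
    have := hlt _ (ρ.get_mem i)
    rw [Finset.mem_product, Finset.mem_range, Finset.mem_range]
    omega
  · rw [Finset.mem_range]; omega
  · omega
  · omega
  · omega
  · omega
  · exact fun i => hlt _ (ρ.get_mem i)

theorem exists_coefficients {k : ℕ} (hk : 2 ≤ k) {Φ : ℝ → (ℕ × ℕ → ℝ) → ℝ}
    (h : Φ ∈ jetSpan (Admissible k)) :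
    ∃ C : (l j : ℕ) → (Fin j → ℕ × ℕ) → ℝ, ∀ ε z, Φ ε z =
      ∑ l ∈ Finset.range k, ε ^ (2 * l) * ∑ j ∈ Finset.Icc 2 (max 2 (k - l)),
        ∑ ρ ∈ indexSet k l j, C l j ρ * ∏ i, z (ρ i) := by
  classical
  refine jetSpan_induction (p := fun Φ => ∃ C : (l j : ℕ) → (Fin j → ℕ × ℕ) → ℝ, ∀ ε z, Φ ε z =
    ∑ l ∈ Finset.range k, ε ^ (2 * l) * ∑ j ∈ Finset.Icc 2 (max 2 (k - l)),
      ∑ ρ ∈ indexSet k l j, C l j ρ * ∏ i, z (ρ i)) ?_ ?_ ?_ ?_ h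
  · intro l ρ hG
    obtain ⟨h1, h2, h3⟩ := hG.mem_indexSet hk
    -- For a single monomial the coefficient is the indicator of its own index.
    refine ⟨fun l' j σ => if l' = l ∧ List.ofFn σ = ρ then 1 else 0, fun ε z => ?_⟩
    rw [Finset.sum_eq_single_of_mem l (Finset.mem_range.2 h1),
      Finset.sum_eq_single_of_mem ρ.length h2, Finset.sum_eq_single_of_mem ρ.get h3]
    · simp only [List.ofFn_get, and_self, if_true, one_mul, jetMonomial]
      congr 1
      rw [← List.prod_ofFn]; congr 1; apply List.ext_get <;> simp
    · intro σ _ hσ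
      beta_reduce
      rw [if_neg, zero_mul]
      rintro ⟨-, e⟩
      apply hσ
      rw [← List.ofFn_inj, e, List.ofFn_get]
    · intro j _ hj
      refine Finset.sum_eq_zero fun σ _ => ?_
      beta_reduce
      rw [if_neg, zero_mul]
      rintro ⟨-, e⟩
      exact hj (by rw [← e, List.length_ofFn])
    · intro l' _ hl
      simp [hl]
  · exact ⟨fun _ _ _ => 0, by simp⟩
  · intro f g hf hg
    obtain ⟨C, hC⟩ := hf
    obtain ⟨C', hC'⟩ := hg
    refine ⟨fun l j ρ => C l j ρ + C' l j ρ, fun ε z => ?_⟩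
    simp only [Pi.add_apply, hC, hC', add_mul, Finset.sum_add_distrib, mul_add]
  · intro c f hf
    obtain ⟨C, hC⟩ := hf
    refine ⟨fun l j ρ => c * C l j ρ, fun ε z => ?_⟩
    simp only [Pi.smul_apply, smul_eq_mul, hC, Finset.mul_sum]
    refine Finset.sum_congr rfl fun _ _ => Finset.sum_congr rfl fun _ _ =>
      Finset.sum_congr rfl fun _ _ => by ring

/-! ### Tangential derivatives of jet polynomials. -/

/-- The jet of the vorticity at the wall: `z i (a₁, a₂)` is `∂ₜⁱ ∂ₓ^a₁ ∂_y^a₂ w` at `y = 0`. It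
satisfies the vorticity equation and is differentiable up to the parabolic order `n`. -/
structure WallJet (n : ℕ) (T ε : ℝ) (z : ℕ → ℕ × ℕ → ℝ → ℝ → ℝ) : Prop where
  time : ∀ a : ℕ × ℕ, a.1 + a.2 + 2 ≤ n → ∀ t ∈ Icc 0 T, ∀ x,
    HasDerivWithinAt (fun τ => z 0 a τ x) (z 1 a t x) (Icc 0 T) t
  space : ∀ i (a : ℕ × ℕ), 2 * i + a.1 + a.2 + 1 ≤ n → ∀ t ∈ Icc 0 T, ∀ x,
    HasDerivAt (z i a t) (z i (a.1 + 1, a.2) t x) x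
  transport : ∀ b, b + 2 ≤ n → ∀ t ∈ Icc 0 T, ∀ x,
    z 1 (0, b) t x + wallTransport (b + 1) (fun a => z 0 a t x) =
      -z 0 (0, b) t x + ε ^ 2 * z 0 (2, b) t x + z 0 (0, b + 2) t x

theorem exists_deriv_monomial (N l : ℕ) (ρ : List (ℕ × ℕ)) (hρ : ∀ a ∈ ρ, a.1 + a.2 + 1 ≤ N) :
    ∃ Φ ∈ jetSpan fun l' ρ' => l' = l ∧ XStep ρ ρ', ∀ n T ε z, WallJet n T ε z → N ≤ n →
      ∀ t ∈ Icc 0 T, ∀ x, HasDerivAt (fun ξ => jetMonomial l ρ ε fun a => z 0 a t ξ)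
        (Φ ε fun a => z 0 a t x) x := by
  induction ρ generalizing l with
  | nil =>
    refine ⟨0, zero_mem _, fun n T ε z _ _ t _ x => ?_⟩
    simpa [jetMonomial] using hasDerivAt_const x (ε ^ (2 * l))
  | cons a ρ ih =>
    obtain ⟨Φ, hΦ, H⟩ := ih l fun c hc => hρ c (by simp [hc])
    refine ⟨jetMonomial l ((a.1 + 1, a.2) :: ρ) + jetMonomial 0 [a] * Φ,
      add_mem (jetMonomial_mem ⟨rfl, .head a ρ⟩) (jetMonomial_mul_mem (fun l' ρ' h => ?_) hΦ),
      fun n T ε z hz hn t ht x => ?_⟩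
    · exact ⟨by rw [h.1, zero_add], h.2.cons a⟩
    · have h1 := hz.space 0 a (by have := hρ a (by simp); omega) t ht x
      have h2 := h1.mul (H n T ε z hz hn t ht x)
      refine (h2.congr_deriv ?_).congr_of_eventuallyEq (Eventually.of_forall fun ξ => ?_)
      · simp [jetMonomial]; ring
      · simp [jetMonomial]; ring

theorem exists_deriv (N : ℕ) {G : ℕ → List (ℕ × ℕ) → Prop}
    (hG : ∀ l ρ, G l ρ → ∀ a ∈ ρ, a.1 + a.2 + 1 ≤ N)
    {Φ : ℝ → (ℕ × ℕ → ℝ) → ℝ} (hΦ : Φ ∈ jetSpan G) :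
    ∃ Φ' ∈ jetSpan fun l ρ' => ∃ ρ, G l ρ ∧ XStep ρ ρ', ∀ n T ε z, WallJet n T ε z → N ≤ n →
      ∀ t ∈ Icc 0 T, ∀ x, HasDerivAt (fun ξ => Φ ε fun a => z 0 a t ξ)
        (Φ' ε fun a => z 0 a t x) x := by
  refine jetSpan_induction (p := fun Φ => ∃ Φ' ∈ jetSpan fun l ρ' => ∃ ρ, G l ρ ∧ XStep ρ ρ',
      ∀ n T ε z, WallJet n T ε z → N ≤ n → ∀ t ∈ Icc 0 T, ∀ x,
        HasDerivAt (fun ξ => Φ ε fun a => z 0 a t ξ) (Φ' ε fun a => z 0 a t x) x) ?_ ?_ ?_ ?_ hΦ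
  · intro l ρ h
    obtain ⟨Φ', h1, h2⟩ := exists_deriv_monomial N l ρ (hG l ρ h)
    exact ⟨Φ', jetSpan_mono (fun l' ρ' h' => ⟨ρ, h'.1 ▸ h, h'.2⟩) h1, h2⟩
  · exact ⟨0, zero_mem _, fun n T ε z _ _ t _ x => hasDerivAt_const x 0⟩
  · rintro f g ⟨f', h1, h2⟩ ⟨g', h3, h4⟩
    exact ⟨f' + g', add_mem h1 h3, fun n T ε z hz hn t ht x =>
      (h2 n T ε z hz hn t ht x).add (h4 n T ε z hz hn t ht x)⟩
  · rintro c f ⟨f', h1, h2⟩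
    exact ⟨c • f', Submodule.smul_mem _ _ h1, fun n T ε z hz hn t ht x =>
      (h2 n T ε z hz hn t ht x).const_mul c⟩

/-- The pairs which occur in `D^a (u ∂_x w + v ∂_y w)` at the wall. -/
def TransportPair (a : ℕ × ℕ) (l : ℕ) (ρ : List (ℕ × ℕ)) : Prop :=
  l = 0 ∧ ∃ c d : ℕ × ℕ, ρ = [c, d] ∧ c.1 + d.1 = a.1 + 1 ∧ c.2 + d.2 + 1 = a.2

theorem TransportPair.xStep {a l ρ ρ'} (h : TransportPair a l ρ) (hs : XStep ρ ρ') :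
    TransportPair (a.1 + 1, a.2) l ρ' := by
  obtain ⟨hl, c, d, rfl, h1, h2⟩ := h
  refine ⟨hl, ?_⟩
  cases hs with
  | head => exact ⟨_, _, rfl, by simp; omega, by simp; omega⟩
  | cons _ hs =>
    cases hs with
    | head => exact ⟨_, _, rfl, by simp; omega, by simp; omega⟩
    | cons _ hs => cases hs

/-- The vorticity equation at the wall holds for all x, so it may be differentiated along the wall;
only the case of pure y-derivatives comes from the equation itself. -/
theorem exists_evolution (a : ℕ × ℕ) :
    ∃ Q ∈ jetSpan (TransportPair a), ∀ n T ε z, WallJet n T ε z → a.1 + a.2 + 2 ≤ n →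
      ∀ t ∈ Icc 0 T, ∀ x, z 1 a t x + Q ε (fun c => z 0 c t x) =
        -z 0 a t x + ε ^ 2 * z 0 (a.1 + 2, a.2) t x + z 0 (a.1, a.2 + 2) t x := by
  obtain ⟨a1, a2⟩ := a
  induction a1 with
  | zero =>
    refine ⟨_, jetSpan_mono (fun l ρ h => ?_) (wallTransport_mem a2),
      fun n T ε z hz hn t ht x => hz.transport a2 (by simpa using hn) t ht x⟩
    exact h
  | succ a1 ih =>
    obtain ⟨Q, hQ, H⟩ := ih
    obtain ⟨Q', hQ', H'⟩ := exists_deriv (a1 + a2 + 3) (G := TransportPair (a1, a2))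
      (by
        rintro l ρ ⟨-, c, d, rfl, h1, h2⟩
        simp only [List.mem_cons, List.not_mem_nil, or_false, forall_eq_or_imp, forall_eq]
        simp only at h1 h2
        omega) hQ
    refine ⟨Q', jetSpan_mono ?_ hQ', fun n T ε z hz hn t ht x => ?_⟩
    · rintro l ρ' ⟨ρ, h, hs⟩
      exact h.xStep hs
    · simp only at hn H ⊢
      have e1 := (hz.space 1 (a1, a2) (by simp only; omega) t ht x).add
        (H' n T ε z hz (by omega) t ht x)
      have e2 := ((hz.space 0 (a1, a2) (by simp only; omega) t ht x).neg.add
        ((hz.space 0 (a1 + 2, a2) (by simp only; omega) t ht x).const_mul (ε ^ 2))).add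
        (hz.space 0 (a1, a2 + 2) (by simp only; omega) t ht x)
      refine e1.unique (e2.congr_of_eventuallyEq (Eventually.of_forall fun ξ => ?_))
      exact H n T ε z hz (by omega) t ht ξ

/-! ### The heat operator on jet polynomials. -/

/-- `gx` is `∂ₓ g` and `h` is `(∂ₜ - ε² ∂ₓ²) g`, for `t ∈ [0, T]`. -/
def HasHeat (T ε : ℝ) (g gx h : ℝ → ℝ → ℝ) : Prop :=
  ∀ t ∈ Icc 0 T, ∀ x, HasDerivAt (g t) (gx t x) x ∧ ∃ gt gxx,
    HasDerivWithinAt (fun τ => g τ x) gt (Icc 0 T) t ∧ HasDerivAt (gx t) gxx x ∧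
      h t x = gt - ε ^ 2 * gxx

namespace HasHeat

variable {T ε : ℝ} {g gx h g' gx' h' : ℝ → ℝ → ℝ}

theorem add (H : HasHeat T ε g gx h) (H' : HasHeat T ε g' gx' h') :
    HasHeat T ε (fun t x => g t x + g' t x) (fun t x => gx t x + gx' t x)
      fun t x => h t x + h' t x := by
  intro t ht x
  obtain ⟨h1, a, b, h2, h3, h4⟩ := H t ht x
  obtain ⟨h1', a', b', h2', h3', h4'⟩ := H' t ht x
  exact ⟨h1.add h1', a + a', b + b', h2.add h2', h3.add h3', by simp only [h4, h4']; ring⟩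

theorem const_mul (c : ℝ) (H : HasHeat T ε g gx h) :
    HasHeat T ε (fun t x => c * g t x) (fun t x => c * gx t x) fun t x => c * h t x := by
  intro t ht x
  obtain ⟨h1, a, b, h2, h3, h4⟩ := H t ht x
  exact ⟨h1.const_mul c, c * a, c * b, h2.const_mul c, h3.const_mul c, by simp only [h4]; ring⟩

theorem zero : HasHeat T ε (fun _ _ => 0) (fun _ _ => 0) fun _ _ => 0 :=
  fun t _ x => ⟨hasDerivAt_const x 0, 0, 0, hasDerivWithinAt_const t _ 0, hasDerivAt_const x 0,
    by simp⟩

theorem mul (H : HasHeat T ε g gx h) (H' : HasHeat T ε g' gx' h') :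
    HasHeat T ε (fun t x => g t x * g' t x) (fun t x => gx t x * g' t x + g t x * gx' t x)
      fun t x => h t x * g' t x + g t x * h' t x - 2 * ε ^ 2 * (gx t x * gx' t x) := by
  intro t ht x
  obtain ⟨h1, a, b, h2, h3, h4⟩ := H t ht x
  obtain ⟨h1', a', b', h2', h3', h4'⟩ := H' t ht x
  exact ⟨h1.mul h1', _, _, h2.mul h2', (h3.mul h1').add (h1.mul h3'), by simp only [h4, h4']; ring⟩

theorem sum {ι : Type*} (s : Finset ι) {g gx h : ι → ℝ → ℝ → ℝ}
    (H : ∀ i ∈ s, HasHeat T ε (g i) (gx i) (h i)) :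
    HasHeat T ε (fun t x => ∑ i ∈ s, g i t x) (fun t x => ∑ i ∈ s, gx i t x)
      fun t x => ∑ i ∈ s, h i t x := by
  classical
  induction s using Finset.induction_on with
  | empty => simpa using zero
  | insert i s hi ih =>
    simp only [Finset.sum_insert hi]
    exact (H i (by simp)).add (ih fun j hj => H j (by simp [hj]))

theorem congr (H : HasHeat T ε g gx h) (e : ∀ t ∈ Icc 0 T, ∀ x, g' t x = g t x)
    (e' : ∀ t ∈ Icc 0 T, ∀ x, h' t x = h t x) : HasHeat T ε g' gx h' := by
  intro t ht x
  obtain ⟨h1, a, b, h2, h3, h4⟩ := H t ht x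
  refine ⟨?_, a, b, h2.congr (fun τ hτ => e τ hτ x) (e t ht x), h3, by rw [e' t ht, h4]⟩
  rwa [funext (e t ht)]

theorem heatOp_eq (hT : 0 < T) (H : HasHeat T ε g gx h) {t : ℝ} (ht : t ∈ Icc 0 T) (x : ℝ) :
    heatOp T ε g t x = h t x := by
  obtain ⟨-, a, b, h2, h3, h4⟩ := H t ht x
  have e : deriv (g t) = gx t := funext fun ξ => (H t ht ξ).1.deriv
  rw [heatOp, h2.derivWithin (uniqueDiffOn_Icc hT t ht), iteratedDeriv_succ, iteratedDeriv_one, e,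
    h3.deriv, h4]

end HasHeat

theorem jet_hasHeat {n T ε z} (hz : WallJet n T ε z) {a : ℕ × ℕ} (ha : a.1 + a.2 + 2 ≤ n) :
    HasHeat T ε (z 0 a) (z 0 (a.1 + 1, a.2))
      fun t x => z 1 a t x - ε ^ 2 * z 0 (a.1 + 2, a.2) t x :=
  fun t ht x => ⟨hz.space 0 a (by omega) t ht x, _, _, hz.time a ha t ht x,
    hz.space 0 (a.1 + 1, a.2) (by simp only; omega) t ht x, rfl⟩

/-- Product rule for the first factor against the rest, with `exists_evolution` eliminating the time
derivative. The first-order derivative Φ is tracked because the cross term needs it. -/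
theorem exists_heat_monomial (N : ℕ) (ρ : List (ℕ × ℕ)) (hρ : ∀ a ∈ ρ, a.1 + a.2 + 2 ≤ N) :
    ∃ Φ ∈ jetSpan fun l ρ' => l = 0 ∧ XStep ρ ρ', ∃ Ψ ∈ jetSpan (HeatStep ρ), ∀ n T ε z,
      WallJet n T ε z → N ≤ n → HasHeat T ε (fun t x => jetMonomial 0 ρ ε fun a => z 0 a t x)
        (fun t x => Φ ε fun a => z 0 a t x) fun t x => Ψ ε fun a => z 0 a t x := by
  induction ρ with
  | nil =>
    refine ⟨0, zero_mem _, 0, zero_mem _, fun n T ε z _ _ t _ x => ?_⟩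
    simpa [jetMonomial] using ⟨hasDerivAt_const x (1 : ℝ), 0, hasDerivWithinAt_const t _ (1 : ℝ), 0,
      hasDerivAt_const x (0 : ℝ), by simp⟩
  | cons a ρ ih =>
    obtain ⟨Φ, hΦ, Ψ, hΨ, H⟩ := ih fun c hc => hρ c (by simp [hc])
    obtain ⟨Q, hQ, HQ⟩ := exists_evolution a
    have ha := hρ a (by simp)
    refine ⟨jetMonomial 0 ((a.1 + 1, a.2) :: ρ) + jetMonomial 0 [a] * Φ, ?_,
      jetMonomial 0 ((a.1, a.2 + 2) :: ρ) - jetMonomial 0 (a :: ρ) - Q * jetMonomial 0 ρ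
        + jetMonomial 0 [a] * Ψ - (2 : ℝ) • (jetMonomial 1 [(a.1 + 1, a.2)] * Φ), ?_, ?_⟩
    · refine add_mem (jetMonomial_mem ⟨rfl, .head a ρ⟩) (jetMonomial_mul_mem (fun l ρ' h => ?_) hΦ)
      exact ⟨by rw [h.1], h.2.cons a⟩
    · refine sub_mem (add_mem (sub_mem (sub_mem (jetMonomial_mem (.diffuse a ρ))
        (jetMonomial_mem (.self a ρ))) (mul_jetMonomial_mem ?_ hQ))
        (jetMonomial_mul_mem (fun l ρ' h => ?_) hΨ))
        (Submodule.smul_mem _ _ (jetMonomial_mul_mem ?_ hΦ))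
      · rintro l _ ⟨rfl, c, d, rfl, h1, h2⟩
        exact .split a c d ρ h1 h2
      · rw [zero_add]; exact h.cons a
      · rintro l ρ' ⟨rfl, h⟩
        exact .cross a h
    · intro n T ε z hz hn
      have h1 := (jet_hasHeat hz (a := a) (by omega)).mul (H n T ε z hz hn)
      -- `HasHeat.congr` leaves the x-derivative untouched, so that slot is rewritten separately.
      have e : ∀ Φ' Ψ' : ℝ → ℝ → ℝ, ∀ g, (HasHeat T ε g Φ' Ψ' → ∀ Φ'', Φ'' = Φ' →
          HasHeat T ε g Φ'' Ψ') := fun _ _ _ h _ e => e ▸ h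
      refine e _ _ _ (h1.congr (fun t ht x => ?_) fun t ht x => ?_) _ (funext₂ fun t x => ?_)
      · simp [jetMonomial]
      · have := HQ n T ε z hz (by omega) t ht x
        simp only [jetMonomial, Pi.add_apply, Pi.sub_apply, Pi.mul_apply, Pi.smul_apply,
          smul_eq_mul, List.map_cons, List.prod_cons, List.map_nil, List.prod_nil]
        linear_combination (-(List.map (fun a => z 0 a t x) ρ).prod) * this
      · simp [jetMonomial]

theorem exists_heat (N : ℕ) {G G' : ℕ → List (ℕ × ℕ) → Prop}
    (hG : ∀ l ρ, G l ρ → ∀ a ∈ ρ, a.1 + a.2 + 2 ≤ N)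
    (hG' : ∀ l ρ δ ρ', G l ρ → HeatStep ρ δ ρ' → G' (l + δ) ρ')
    {Φ : ℝ → (ℕ × ℕ → ℝ) → ℝ} (hΦ : Φ ∈ jetSpan G) :
    ∃ Φ' : ℝ → (ℕ × ℕ → ℝ) → ℝ, ∃ Ψ ∈ jetSpan G', ∀ n T ε z, WallJet n T ε z → N ≤ n →
      HasHeat T ε (fun t x => Φ ε fun a => z 0 a t x)
        (fun t x => Φ' ε fun a => z 0 a t x) fun t x => Ψ ε fun a => z 0 a t x := by
  refine jetSpan_induction (p := fun Φ => ∃ Φ' : ℝ → (ℕ × ℕ → ℝ) → ℝ, ∃ Ψ ∈ jetSpan G',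
    ∀ n T ε z, WallJet n T ε z → N ≤ n → HasHeat T ε (fun t x => Φ ε fun a => z 0 a t x)
      (fun t x => Φ' ε fun a => z 0 a t x) fun t x => Ψ ε fun a => z 0 a t x) ?_ ?_ ?_ ?_ hΦ
  · intro l ρ h
    obtain ⟨Φ', -, Ψ, h2, H⟩ := exists_heat_monomial N ρ (hG l ρ h)
    refine ⟨fun ε z => ε ^ (2 * l) * Φ' ε z, jetMonomial l [] * Ψ, jetMonomial_mul_mem
      (fun δ ρ' hs => hG' l ρ δ ρ' h hs) h2, fun n T ε z hz hn =>
      ((H n T ε z hz hn).const_mul (ε ^ (2 * l))).congr (fun t ht x => ?_) fun t ht x => ?_⟩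
    · simp [jetMonomial]
    · simp [jetMonomial]
  · exact ⟨0, 0, zero_mem _, fun n T ε z _ _ => .zero⟩
  · rintro f g ⟨f', f'', h1, h2⟩ ⟨g', g'', h3, h4⟩
    exact ⟨f' + g', f'' + g'', add_mem h1 h3, fun n T ε z hz hn =>
      (h2 n T ε z hz hn).add (h4 n T ε z hz hn)⟩
  · rintro c f ⟨f', f'', h1, h2⟩
    exact ⟨c • f', c • f'', Submodule.smul_mem _ _ h1, fun n T ε z hz hn =>
      (h2 n T ε z hz hn).const_mul c⟩

/-! ### The expansion of the odd normal derivatives. -/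

/-- Pascal's rule, in the form (1 + L)^(k+1) = (1 + L)^k + L(1 + L)^k. -/
theorem sum_choose_succ_mul (k : ℕ) (g : ℕ → ℝ) :
    ∑ i ∈ Finset.range (k + 1 + 1), ((k + 1).choose i : ℝ) * g i =
      ∑ i ∈ Finset.range (k + 1), (k.choose i : ℝ) * g i +
        ∑ i ∈ Finset.range (k + 1), (k.choose i : ℝ) * g (i + 1) := by
  have h : ∑ i ∈ Finset.range (k + 1), (k.choose i : ℝ) * g i =
      ∑ i ∈ Finset.range (k + 1 + 1), (k.choose i : ℝ) * g i := by
    rw [Finset.sum_range_succ _ (k + 1)]; simp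
  rw [h, Finset.sum_range_succ' _ (k + 1), Finset.sum_range_succ' _ (k + 1)]
  simp only [Nat.choose_succ_succ, Nat.cast_add, add_mul, Finset.sum_add_distrib,
    Nat.choose_zero_right]
  ring

/-- The induction is strong because the lower expansions also supply the differentiability of the
iterates of `heatOp` on K, for which no regularity is assumed beyond the identification with the
jet. -/
theorem exists_expansion (k : ℕ) :
    ∃ Φ ∈ jetSpan (Admissible k), ∀ n T ε z K, 0 < T → WallJet n T ε z →
      (∀ t ∈ Icc 0 T, ∀ x, K t x = z 0 (0, 1) t x) → 2 * k + 1 ≤ n → ∀ t ∈ Icc 0 T, ∀ x,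
        z 0 (0, 2 * k + 1) t x =
          ∑ i ∈ Finset.range (k + 1), (k.choose i : ℝ) * (heatOp T ε)^[i] K t x
            + Φ ε fun a => z 0 a t x := by
  induction k using Nat.strong_induction_on with
  | _ k ih =>
    rcases k with _ | k
    · refine ⟨0, zero_mem _, fun n T ε z K _ _ hK _ t ht x => ?_⟩
      simp [hK t ht x]
    have step : ∀ j ≤ k, ∃ Φ Φ' : ℝ → (ℕ × ℕ → ℝ) → ℝ, ∃ Ψ ∈ jetSpan (Admissible (j + 1)),
        Φ ∈ jetSpan (Admissible j) ∧ (∀ n T ε z K, 0 < T → WallJet n T ε z →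
          (∀ t ∈ Icc 0 T, ∀ x, K t x = z 0 (0, 1) t x) → 2 * j + 1 ≤ n → ∀ t ∈ Icc 0 T, ∀ x,
          z 0 (0, 2 * j + 1) t x =
            ∑ i ∈ Finset.range (j + 1), (j.choose i : ℝ) * (heatOp T ε)^[i] K t x
              + Φ ε fun a => z 0 a t x) ∧ ∀ n T ε z, WallJet n T ε z → 2 * j + 3 ≤ n →
          HasHeat T ε (fun t x => Φ ε fun a => z 0 a t x)
            (fun t x => Φ' ε fun a => z 0 a t x) fun t x => Ψ ε fun a => z 0 a t x := by
      intro j hj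
      obtain ⟨Φ, h1, h2⟩ := ih j (by omega)
      obtain ⟨Φ', Ψ, h3, h4⟩ := exists_heat (2 * j + 3) (G := Admissible j)
        (fun l ρ h a ha => by have := h.order_lt ha; omega)
        (fun l ρ δ ρ' h hs => h.heatStep hs) h1
      exact ⟨Φ, Φ', Ψ, h3, h1, h2, h4⟩
    -- `heatOp` is linear only where true derivatives exist. The expansion at level j has top
    -- coefficient 1, so it can be solved for L^j K in terms of the jet and the lower iterates, all
    -- of which are differentiable.
    have heat : ∀ n T ε z K, 0 < T → WallJet n T ε z →
        (∀ t ∈ Icc 0 T, ∀ x, K t x = z 0 (0, 1) t x) → ∀ j ≤ k, 2 * j + 3 ≤ n →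
        ∃ gx, HasHeat T ε ((heatOp T ε)^[j] K) gx ((heatOp T ε)^[j + 1] K) := by
      intro n T ε z K hT hz hK j
      induction j using Nat.strong_induction_on with
      | _ j ihj =>
        intro hj hn
        obtain ⟨Φ, Φ', Ψ, -, -, h2, h4⟩ := step j hj
        have : ∀ i, ∃ gx, i < j →
            HasHeat T ε ((heatOp T ε)^[i] K) gx ((heatOp T ε)^[i + 1] K) := fun i => by
          by_cases hi : i < j
          · obtain ⟨gx, h⟩ := ihj i hi (by omega) (by omega)
            exact ⟨gx, fun _ => h⟩
          · exact ⟨0, fun h => absurd h hi⟩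
        choose gx hgx using this
        have key := ((jet_hasHeat hz (a := (0, 2 * j + 1)) (by simp only; omega)).add
          ((h4 n T ε z hz hn).const_mul (-1))).add ((HasHeat.sum (Finset.range j) fun i hi =>
            (hgx i (Finset.mem_range.1 hi)).const_mul (j.choose i : ℝ)).const_mul (-1))
        have key' := key.congr (g' := (heatOp T ε)^[j] K) (fun t ht x => by
          have := h2 n T ε z K hT hz hK (by omega) t ht x
          rw [Finset.sum_range_succ, Nat.choose_self] at this
          rw [this]; push_cast; ring) fun _ _ _ => rfl
        refine ⟨_, key'.congr (fun _ _ _ => rfl) fun t ht x => ?_⟩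
        rw [Function.iterate_succ_apply', key'.heatOp_eq hT ht]
    obtain ⟨Φ, Φ', Ψ, hΨ, hΦ, h2, h4⟩ := step k le_rfl
    obtain ⟨Q, hQ, HQ⟩ := exists_evolution (0, 2 * k + 1)
    refine ⟨Ψ + Φ + Q, add_mem (add_mem hΨ (jetSpan_mono (fun _ _ h => h.keep) hΦ))
      (jetSpan_mono ?_ hQ), fun n T ε z K hT hz hK hn t ht x => ?_⟩
    · rintro l _ ⟨rfl, c, d, rfl, e1, e2⟩
      exact admissible_pair k (by simpa using e1) (by simpa using e2)
    have : ∀ i, ∃ gx, i ≤ k →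
        HasHeat T ε ((heatOp T ε)^[i] K) gx ((heatOp T ε)^[i + 1] K) := fun i => by
      by_cases hi : i ≤ k
      · obtain ⟨gx, h⟩ := heat n T ε z K hT hz hK i hi (by omega)
        exact ⟨gx, fun _ => h⟩
      · exact ⟨0, fun h => absurd h hi⟩
    choose gx hgx using this
    -- L is applied to both sides of the expansion at level k; comparison with `exists_evolution`
    -- for ∂_y^(2k+1) w then gives level k + 1.
    have hsum := ((HasHeat.sum (Finset.range (k + 1)) fun i hi =>
      (hgx i (by rw [Finset.mem_range] at hi; omega)).const_mul (k.choose i : ℝ)).add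
        (h4 n T ε z hz (by omega))).congr
      (fun t ht x => h2 n T ε z K hT hz hK (by omega) t ht x) fun _ _ _ => rfl
    have e1 := (hsum.heatOp_eq hT ht x).symm.trans
      ((jet_hasHeat hz (a := (0, 2 * k + 1)) (by simp only; omega)).heatOp_eq hT ht x)
    have e2 := HQ n T ε z hz (by simp only; omega) t ht x
    have e3 := h2 n T ε z K hT hz hK (by omega) t ht x
    have e4 : ∑ i ∈ Finset.range (k + 1 + 1), ((k + 1).choose i : ℝ) * (heatOp T ε)^[i] K t x =
        ∑ i ∈ Finset.range (k + 1), (k.choose i : ℝ) * (heatOp T ε)^[i] K t x +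
        ∑ i ∈ Finset.range (k + 1), (k.choose i : ℝ) * (heatOp T ε)^[i + 1] K t x :=
      sum_choose_succ_mul k fun i => (heatOp T ε)^[i] K t x
    rw [e4]
    simp only [Pi.add_apply, zero_add] at e1 e2 ⊢
    rw [show 2 * (k + 1) + 1 = 2 * k + 1 + 2 by ring]
    linear_combination e3 - e1 - e2

/-! ### From the solution to its jet at the wall. -/

/-- The function `F i a b` is the partial derivative `∂ₜⁱ ∂ₓᵃ ∂_yᵇ` of `F 0 0 0` on
`[0, T] × ℝ × [0, ∞)` up to the parabolic order `m`. -/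
structure IsPartials (T : ℝ) (m : ℕ) (F : ℕ → ℕ → ℕ → ℝ → ℝ → ℝ → ℝ) : Prop where
  time : ∀ i a b, 2 * (i + 1) + a + b ≤ m → ∀ t ∈ Icc 0 T, ∀ x, ∀ y ∈ Ici (0 : ℝ),
    HasDerivWithinAt (fun τ => F i a b τ x y) (F (i + 1) a b t x y) (Icc 0 T) t
  space : ∀ i a b, 2 * i + (a + 1) + b ≤ m → ∀ t ∈ Icc 0 T, ∀ x, ∀ y ∈ Ici (0 : ℝ),
    HasDerivAt (fun ξ => F i a b t ξ y) (F i (a + 1) b t x y) x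
  normal : ∀ i a b, 2 * i + a + (b + 1) ≤ m → ∀ t ∈ Icc 0 T, ∀ x, ∀ y ∈ Ici (0 : ℝ),
    HasDerivWithinAt (fun η => F i a b t x η) (F i a (b + 1) t x y) (Ici 0) y

theorem ParabolicC.exists_partials {T m f} (h : ParabolicC T m f) :
    ∃ F, IsPartials T m F ∧ ∀ t ∈ Icc 0 T, ∀ x, ∀ y ∈ Ici (0 : ℝ), F 0 0 0 t x y = f t x y := by
  obtain ⟨F, h0, h⟩ := h
  exact ⟨F, ⟨fun i a b hm t ht x y hy => ((h i a b).2 t ht x y hy).1 hm,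
    fun i a b hm t ht x y hy => ((h i a b).2 t ht x y hy).2.1 hm,
    fun i a b hm t ht x y hy => ((h i a b).2 t ht x y hy).2.2 hm⟩, h0⟩

namespace IsPartials

variable {T : ℝ} {m : ℕ} {F : ℕ → ℕ → ℕ → ℝ → ℝ → ℝ → ℝ}

theorem iteratedDerivWithin_eq (hF : IsPartials T m F) {c : ℕ} {f : ℝ → ℝ → ℝ → ℝ}
    (hf : ∀ t ∈ Icc 0 T, ∀ x, ∀ y ∈ Ici (0 : ℝ), f t x y = F 0 0 c t x y) (b : ℕ)
    (hb : b + c ≤ m) {t : ℝ} (ht : t ∈ Icc 0 T) (x : ℝ) {y : ℝ} (hy : y ∈ Ici (0 : ℝ)) :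
    iteratedDerivWithin b (fun η => f t x η) (Ici 0) y = F 0 0 (c + b) t x y := by
  induction b generalizing y with
  | zero => simpa using hf t ht x y hy
  | succ b ih =>
    rw [iteratedDerivWithin_succ]
    have h := hF.normal 0 0 (c + b) (by omega) t ht x y hy
    exact (h.congr (fun η hη => ih (by omega) hη) (ih (by omega) hy)).derivWithin
      (uniqueDiffOn_Ici 0 y hy)

theorem D_eq (hF : IsPartials T m F) {c : ℕ} {f : ℝ → ℝ → ℝ → ℝ}
    (hf : ∀ t ∈ Icc 0 T, ∀ x, ∀ y ∈ Ici (0 : ℝ), f t x y = F 0 0 c t x y) (ρ : ℕ × ℕ)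
    (hρ : ρ.1 + ρ.2 + c ≤ m) {t : ℝ} (ht : t ∈ Icc 0 T) (x : ℝ) {y : ℝ} (hy : y ∈ Ici (0 : ℝ)) :
    D ρ f t x y = F 0 ρ.1 (c + ρ.2) t x y := by
  obtain ⟨a, b⟩ := ρ
  simp only at hρ
  rw [D]
  have e : (fun ξ => iteratedDerivWithin b (fun η => f t ξ η) (Ici 0) y) =
      fun ξ => F 0 0 (c + b) t ξ y :=
    funext fun ξ => hF.iteratedDerivWithin_eq hf b (by omega) ht ξ hy
  simp only [e]
  clear e
  induction a generalizing x with
  | zero => simp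
  | succ a ih =>
    rw [iteratedDeriv_succ]
    have e : iteratedDeriv a (fun ξ => F 0 0 (c + b) t ξ y) = fun ξ => F 0 a (c + b) t ξ y :=
      funext fun ξ => ih ξ (by omega)
    rw [e]
    exact (hF.space 0 a (c + b) (by omega) t ht x y hy).deriv

end IsPartials

/-- `∂_y^p v`, in terms of `v` and of the derivatives of `u`. -/
def normalDerivatives (F : ℕ → ℕ → ℕ → ℝ → ℝ → ℝ → ℝ) (v : ℝ → ℝ → ℝ → ℝ) :
    ℕ → ℝ → ℝ → ℝ → ℝ
  | 0 => v
  | p + 1 => fun t x y => -F 0 1 p t x y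

section

variable {m : ℕ} {ℓ T ε : ℝ} {U P u₀ : ℝ → ℝ → ℝ} {u v : ℝ → ℝ → ℝ → ℝ}
  {F : ℕ → ℕ → ℕ → ℝ → ℝ → ℝ → ℝ}

theorem momentum_partials (hm : 2 ≤ m) (hT : 0 < T)
    (h : IsRegularizedSolution m ℓ T ε U P u₀ u v) (hF : IsPartials T m F)
    (hu : ∀ t ∈ Icc 0 T, ∀ x, ∀ y ∈ Ici (0 : ℝ), F 0 0 0 t x y = u t x y)
    {t : ℝ} (ht : t ∈ Icc 0 T) (x : ℝ) {y : ℝ} (hy : y ∈ Ici (0 : ℝ)) :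
    F 1 0 0 t x y + F 0 0 0 t x y * F 0 1 0 t x y + v t x y * F 0 0 1 t x y =
      -boundaryDatum U P t x - F 0 0 0 t x y + ε ^ 2 * F 0 2 0 t x y + F 0 0 2 t x y := by
  have hu' : ∀ t ∈ Icc 0 T, ∀ x, ∀ y ∈ Ici (0 : ℝ), u t x y = F 0 0 0 t x y :=
    fun t ht x y hy => (hu t ht x y hy).symm
  have e := h.momentum t ht x y hy
  rw [hF.D_eq hu' (1, 0) (by simp only; omega) ht x hy,
    hF.D_eq hu' (0, 1) (by simp only; omega) ht x hy,
    hF.D_eq hu' (2, 0) (by simp only; omega) ht x hy,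
    hF.D_eq hu' (0, 2) (by simp only; omega) ht x hy, hu' t ht x y hy] at e
  have e1 : dt T u t x y = F 1 0 0 t x y :=
    ((hF.time 0 0 0 (by omega) t ht x y hy).congr (fun τ hτ => hu' τ hτ x y hy)
      (hu' t ht x y hy)).derivWithin (uniqueDiffOn_Icc hT t ht)
  rw [e1] at e
  simp only [zero_add] at e
  rw [boundaryDatum]
  linear_combination e

theorem hasDerivWithinAt_v (hm : 2 ≤ m) (h : IsRegularizedSolution m ℓ T ε U P u₀ u v)
    (hF : IsPartials T m F)
    (hu : ∀ t ∈ Icc 0 T, ∀ x, ∀ y ∈ Ici (0 : ℝ), F 0 0 0 t x y = u t x y)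
    {t : ℝ} (ht : t ∈ Icc 0 T) (x : ℝ) {y : ℝ} (hy : y ∈ Ici (0 : ℝ)) :
    HasDerivWithinAt (fun η => v t x η) (-F 0 1 0 t x y) (Ici 0) y := by
  have h1 := (h.differentiable_v t ht x y hy).hasDerivWithinAt
  have h2 := h.incompressible t ht x y hy
  rw [hF.D_eq (fun t ht x y hy => (hu t ht x y hy).symm) (1, 0) (by simp only; omega) ht x hy] at h2
  have h3 : D (0, 1) v t x y = derivWithin (v t x) (Ici 0) y := by
    simp [D, iteratedDerivWithin_one]
  rw [h3] at h2
  have h4 : derivWithin (v t x) (Ici 0) y = -F 0 1 0 t x y := by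
    simp only [zero_add] at h2
    linarith
  rwa [h4] at h1

/-- The datum ∂ₓP - U does not depend on y, so it is present only for b = 0. Higher y-derivatives of
v come from incompressibility, through `normalDerivatives`. -/
theorem momentum_normal_derivative (hT : 0 < T)
    (h : IsRegularizedSolution m ℓ T ε U P u₀ u v) (hF : IsPartials T m F)
    (hu : ∀ t ∈ Icc 0 T, ∀ x, ∀ y ∈ Ici (0 : ℝ), F 0 0 0 t x y = u t x y) (b : ℕ) (hb : b + 2 ≤ m)
    {t : ℝ} (ht : t ∈ Icc 0 T) (x : ℝ) {y : ℝ} (hy : y ∈ Ici (0 : ℝ)) :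
    F 1 0 b t x y + leibniz b (fun p => F 0 0 p t x y) (fun p => F 0 1 p t x y)
        + leibniz b (fun p => normalDerivatives F v p t x y) (fun p => F 0 0 (p + 1) t x y) =
      (if b = 0 then -boundaryDatum U P t x else 0) - F 0 0 b t x y + ε ^ 2 * F 0 2 b t x y
        + F 0 0 (b + 2) t x y := by
  induction b generalizing y with
  | zero => simpa [leibniz, normalDerivatives] using momentum_partials (by omega) hT h hF hu ht x hy
  | succ b ih =>
    have h1 := ((hF.normal 1 0 b (by omega) t ht x y hy).add
      (hasDerivWithinAt_leibniz b (fun p => F 0 0 p t x) (fun p => F 0 1 p t x)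
        (fun p hp => hF.normal 0 0 p (by omega) t ht x y hy)
        fun p hp => hF.normal 0 1 p (by omega) t ht x y hy)).add
      (hasDerivWithinAt_leibniz b (fun p => normalDerivatives F v p t x)
        (fun p => F 0 0 (p + 1) t x)
        (fun p hp => by
          rcases p with _ | p
          · exact hasDerivWithinAt_v (by omega) h hF hu ht x hy
          · exact (hF.normal 0 1 p (by omega) t ht x y hy).neg)
        fun p hp => hF.normal 0 0 (p + 1) (by omega) t ht x y hy)
    have h2 := (((hF.normal 0 0 b (by omega) t ht x y hy).const_sub
      (if b = 0 then -boundaryDatum U P t x else 0)).add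
      ((hF.normal 0 2 b (by omega) t ht x y hy).const_mul (ε ^ 2))).add
      (hF.normal 0 0 (b + 2) (by omega) t ht x y hy)
    have h3 := (uniqueDiffOn_Ici (0 : ℝ) y hy).eq_deriv _ h1
      (h2.congr (fun η hη => ih (by omega) hη) (ih (by omega) hy))
    rw [h3, if_neg (Nat.succ_ne_zero b)]
    ring

theorem wall_values (hm : 2 ≤ m) (hT : 0 < T)
    (h : IsRegularizedSolution m ℓ T ε U P u₀ u v) (hF : IsPartials T m F)
    (hu : ∀ t ∈ Icc 0 T, ∀ x, ∀ y ∈ Ici (0 : ℝ), F 0 0 0 t x y = u t x y)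
    {t : ℝ} (ht : t ∈ Icc 0 T) (x : ℝ) :
    F 0 0 0 t x 0 = 0 ∧ F 1 0 0 t x 0 = 0 ∧ F 0 1 0 t x 0 = 0 ∧ F 0 2 0 t x 0 = 0 := by
  have h0 : ∀ t ∈ Icc 0 T, ∀ x, F 0 0 0 t x 0 = 0 := fun t ht x => by
    rw [hu t ht x 0 self_mem_Ici, h.noslip_u t ht x]
  have h1 : ∀ x, F 0 1 0 t x 0 = 0 := fun x =>
    (hF.space 0 0 0 (by omega) t ht x 0 self_mem_Ici).unique
      ((hasDerivAt_const x (0 : ℝ)).congr_of_eventuallyEq (Eventually.of_forall (h0 t ht)))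
  refine ⟨h0 t ht x, ?_, h1 x, ?_⟩
  · exact (uniqueDiffOn_Icc hT t ht).eq_deriv _ (hF.time 0 0 0 (by omega) t ht x 0 self_mem_Ici)
      ((hasDerivWithinAt_const t _ (0 : ℝ)).congr (fun τ hτ => h0 τ hτ x) (h0 t ht x))
  · exact (hF.space 0 1 0 (by omega) t ht x 0 self_mem_Ici).unique
      ((hasDerivAt_const x (0 : ℝ)).congr_of_eventuallyEq (Eventually.of_forall h1))

theorem boundaryDatum_eq (hm : 2 ≤ m) (hT : 0 < T)
    (h : IsRegularizedSolution m ℓ T ε U P u₀ u v) (hF : IsPartials T m F)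
    (hu : ∀ t ∈ Icc 0 T, ∀ x, ∀ y ∈ Ici (0 : ℝ), F 0 0 0 t x y = u t x y)
    {t : ℝ} (ht : t ∈ Icc 0 T) (x : ℝ) : boundaryDatum U P t x = F 0 0 2 t x 0 := by
  have e := momentum_partials hm hT h hF hu ht x self_mem_Ici
  obtain ⟨h1, h2, h3, h4⟩ := wall_values hm hT h hF hu ht x
  rw [h1, h2, h3, h4, h.noslip_v t ht x] at e
  linarith

/-- One order of regularity is lost because w = ∂_y u. The order b of the transport equation is the
y-derivative of order b + 1 of the momentum equation. -/
theorem isWallJet (hT : 0 < T)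
    (h : IsRegularizedSolution (m + 1) ℓ T ε U P u₀ u v) (hF : IsPartials T (m + 1) F)
    (hu : ∀ t ∈ Icc 0 T, ∀ x, ∀ y ∈ Ici (0 : ℝ), F 0 0 0 t x y = u t x y) :
    WallJet m T ε fun i a t x => F i a.1 (a.2 + 1) t x 0 where
  time a ha t ht x := hF.time 0 a.1 (a.2 + 1) (by omega) t ht x 0 self_mem_Ici
  space i a ha t ht x := hF.space i a.1 (a.2 + 1) (by omega) t ht x 0 self_mem_Ici
  transport b hb t ht x := by
    have e := momentum_normal_derivative hT h hF hu (b + 1) (by omega) ht x self_mem_Ici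
    obtain ⟨h1, -, h3, -⟩ := wall_values (by omega) hT h hF hu ht x
    have e1 : (fun p => F 0 0 p t x 0) = wallU fun a => F 0 a.1 (a.2 + 1) t x 0 :=
      funext fun p => by rcases p with _ | p <;> simp [wallU, h1]
    have e2 : (fun p => F 0 1 p t x 0) = wallUx fun a => F 0 a.1 (a.2 + 1) t x 0 :=
      funext fun p => by rcases p with _ | p <;> simp [wallUx, h3]
    have e3 : (fun p => normalDerivatives F v p t x 0) =
        wallV fun a => F 0 a.1 (a.2 + 1) t x 0 := funext fun p => by
      rcases p with _ | p
      · exact h.noslip_v t ht x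
      · simp only [normalDerivatives, wallV, ← e2]
    rw [e1, e2, e3, if_neg (Nat.succ_ne_zero b)] at e
    rw [wallTransport]
    linear_combination e

end

/-! ### Conclusion. -/

theorem lemma2p1 :
    ∃ C : (k l j : ℕ) → (Fin j → ℕ × ℕ) → ℝ,
      ∀ (s : ℕ) (ℓ T ε : ℝ) (U P : ℝ → ℝ → ℝ) (u₀ : ℝ → ℝ → ℝ) (u v w : ℝ → ℝ → ℝ → ℝ),
        4 ≤ s → 0 < ℓ → 0 < T → 0 < ε →
        IsRegularizedSolution (s + 2) ℓ T ε U P u₀ u v →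
        w = vorticity u →
        ∀ t ∈ Set.Icc 0 T, ∀ x : ℝ,
          D (0, 1) w t x 0 = boundaryDatum U P t x ∧
          D (0, 3) w t x 0 =
            heatOp T ε (boundaryDatum U P) t x + boundaryDatum U P t x
              + w t x 0 * D (1, 0) w t x 0 ∧
          ∀ k : ℕ, 2 ≤ k → 2 * k ≤ s →
            D (0, 2 * k + 1) w t x 0 =
              ∑ i ∈ Finset.range (k + 1),
                (k.choose i : ℝ) * (heatOp T ε)^[i] (boundaryDatum U P) t x
              + ∑ l ∈ Finset.range k, ε ^ (2 * l) *
                  ∑ j ∈ Finset.Icc 2 (max 2 (k - l)), ∑ ρ ∈ indexSet k l j,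
                    C k l j ρ * ∏ i, D (ρ i) w t x 0 := by
  choose Φ hΦ H using exists_expansion
  have hC : ∀ k, ∃ C : (l j : ℕ) → (Fin j → ℕ × ℕ) → ℝ, 2 ≤ k → ∀ ε z, Φ k ε z =
      ∑ l ∈ Finset.range k, ε ^ (2 * l) * ∑ j ∈ Finset.Icc 2 (max 2 (k - l)),
        ∑ ρ ∈ indexSet k l j, C l j ρ * ∏ i, z (ρ i) := fun k => by
    by_cases hk : 2 ≤ k
    · obtain ⟨C, hC⟩ := exists_coefficients hk (hΦ k)
      exact ⟨C, fun _ => hC⟩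
    · exact ⟨fun _ _ _ => 0, fun h => absurd h hk⟩
  choose C hC using hC
  refine ⟨C, ?_⟩
  rintro s ℓ T ε U P u₀ u v w hs - hT - h rfl t ht x
  obtain ⟨F, hF, hu⟩ := h.regular_u.exists_partials
  have hw : ∀ t ∈ Icc 0 T, ∀ x, ∀ y ∈ Ici (0 : ℝ), vorticity u t x y = F 0 0 1 t x y :=
    fun t ht x y hy => hF.D_eq (fun t ht x y hy => (hu t ht x y hy).symm) (0, 1)
      (by simp only; omega) ht x hy
  have hD : ∀ ρ : ℕ × ℕ, ρ.1 + ρ.2 + 1 ≤ s + 2 →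
      D ρ (vorticity u) t x 0 = F 0 ρ.1 (ρ.2 + 1) t x 0 := fun ρ hρ => by
    rw [hF.D_eq hw ρ hρ ht x self_mem_Ici, add_comm 1]
  have hz := isWallJet hT h hF hu
  have hK : ∀ t ∈ Icc 0 T, ∀ x, boundaryDatum U P t x = F 0 0 2 t x 0 :=
    fun t ht x => boundaryDatum_eq (by omega) hT h hF hu ht x
  refine ⟨?_, ?_, fun k hk hks => ?_⟩
  · rw [hD (0, 1) (by simp only; omega), hK t ht x]
  · have e1 := ((jet_hasHeat hz (a := (0, 1)) (by simp only; omega)).congr hK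
      fun _ _ _ => rfl).heatOp_eq hT ht x
    -- At this order the transport term is 2 w ∂ₓw from u ∂ₓu and -w ∂ₓw from v ∂_y u.
    have e2 := hz.transport 1 (by omega) t ht x
    rw [hD (0, 3) (by simp only; omega), hD (1, 0) (by simp only; omega), e1, hK t ht x,
      hw t ht x 0 self_mem_Ici]
    simp only [wallTransport, leibniz, wallU, wallUx, wallV] at e2
    linear_combination -e2
  · rw [hD (0, 2 * k + 1) (by simp only; omega),
      H k (s + 1) T ε _ (boundaryDatum U P) hT hz hK (by omega) t ht x, hC k hk]
    congr 1
    refine Finset.sum_congr rfl fun l _ => congrArg _ (Finset.sum_congr rfl fun j _ =>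
      Finset.sum_congr rfl fun ρ hρ => congrArg _ (Finset.prod_congr rfl fun i _ => ?_))
    rw [indexSet, Finset.mem_filter] at hρ
    -- The order bound in `indexSet` keeps every factor within the regularity where `D` agrees with
    -- the jet.
    have := hρ.2.2.2.2 i
    exact (hD (ρ i) (by omega)).symm
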